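/- Let $R\in\mathbb{R}^{g\times \mathtt{w}}[\xi]$, $M\in\mathbb{R}^{g\times \mathtt{c}}[\xi]$ and $S\in\mathbb{R}^{s\times \mathtt{w}}[\xi]$ be real polynomial matrices. All signals are infinitely differentiable on $\mathbb{R}$. Let $$\mathcal{P}_{\mathrm{full}}=\{(w,c)\in C^\infty(\mathbb{R},\mathbb{R}^{\mathtt{w}+\mathtt{c}}) \mid R(\tfrac{d}{dt})w+M(\tfrac{d}{dt})c=0\}$$ be the full plant behavior, let $\mathcal{S}=\{w\in C^\infty(\mathbb{R},\mathbb{R}^{\mathtt{w}})\mid S(\tfrac{d}{dt})w=0\}$ be the specification, and put $$\mathcal{P}_c=\{c\mid \exists w:\ (w,c)\in\mathcal{P}_{\mathrm{full}}\},\qquad \mathcal{C}_{\mathrm{can}}=\{c\mid \exists w\in\mathcal{S}:\ (w,c)\in\mathcal{P}_{\mathrm{full}}\}.$$ A controller is a set $\mathcal{C}=\{c\in C^\infty(\mathbb{R},\mathbb{R}^{\mathtt{c}})\mid C(\tfrac{d}{dt})c=0\}$ with $C$ a real polynomial matrix. It implements $\mathcal{S}$ if $\{w\mid \exists c\in\mathcal{C}:\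 (w,c)\in\mathcal{P}_{\mathrm{full}}\}=\mathcal{S}$. It is regular if it is the kernel of $C(\tfrac{d}{dt})$ for some polynomial matrix $C$ of full row rank with $$\operatorname{rank}\begin{bmatrix}R&M\\0&C\end{bmatrix}=\operatorname{rank}\begin{bmatrix}R&M\end{bmatrix}+\operatorname{rank}C,$$ where ranks are taken over $\mathbb{R}(\xi)$. The specification $\mathcal{S}$ is implementable if some controller implements it, and regularly implementable if some regular controller implements it. Let $$\mathfrak{C}_{\mathrm{can}}^{\mathrm{reg}}=\{\mathcal{C}\mid \mathcal{C}\text{ is a regular controller and }\mathcal{C}\cap\mathcal{P}_c=\mathcal{C}_{\mathrm{can}}\cap\mathcal{P}_c\}.$$ Assume that $\mathcal{S}$ is implementable. Then $\mathfrak{C}_{\mathrm{can}}^{\mathrm{reg}}$ is nonempty if and only if $\mathcal{S}$ is regularly implementable. Moreover, if $\mathcal{C}$ is any regular controller that implements $\mathcal{S}$, then $\mathcal{C}+\mathcal{C}_{\mathrm{can}}\in\mathfrak{C}_{\mathrm{can}}^{\mathrm{reg}}$. -/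

import Mathlib

open Polynomial
open scoped ContDiff

namespace Behavioral

/-- The real vector space of infinitely differentiable functions from `ℝ` to `ℝ`. -/
def smoothFun : Submodule ℝ (ℝ → ℝ) where
  carrier := {f | ContDiff ℝ ∞ f}
  add_mem' {f g} hf hg := by
    rw [Set.mem_ofPred_eq] at *
    exact ContDiff.add hf hg
  zero_mem' := by
    rw [Set.mem_ofPred_eq]
    exact contDiff_const
  smul_mem' r f hf := by
    rw [Set.mem_ofPred_eq] at *
    exact ContDiff.const_smul r hf

theorem mem_smoothFun {f : ℝ → ℝ} : f ∈ smoothFun ↔ ContDiff ℝ ∞ f := by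
  rw [← SetLike.mem_coe, smoothFun, Submodule.coe_set_mk, AddSubmonoid.coe_set_mk]
  exact Iff.rfl

theorem smoothFun_differentiable (f : smoothFun) : Differentiable ℝ (f : ℝ → ℝ) :=
  (mem_smoothFun.1 f.2).differentiable (by simp)

/-- The operator `d/dt` on infinitely differentiable functions. -/
noncomputable def ddt : smoothFun →ₗ[ℝ] smoothFun where
  toFun f := ⟨deriv (f : ℝ → ℝ),
    mem_smoothFun.2 (contDiff_infty_iff_deriv.1 (mem_smoothFun.1 f.2)).2⟩
  map_add' f g := by
    ext t
    exact deriv_add (smoothFun_differentiable f t) (smoothFun_differentiable g t)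
  map_smul' r f := by
    ext t
    exact deriv_const_smul r (smoothFun_differentiable f t)

/-- The smooth signals with values in `ℝ ^ q`, given by their `q` smooth components. -/
abbrev Traj (q : ℕ) : Type := Fin q → smoothFun

/-- The differential operator `A (d/dt)` of a polynomial matrix `A`:
the `i`-th component of `A (d/dt) w` is the sum over `j` of `A i j (d/dt) (w j)`. -/
noncomputable def diffOp {g q : ℕ} (A : Matrix (Fin g) (Fin q) ℝ[X]) :
    Traj q →ₗ[ℝ] Traj g where
  toFun w := fun i => ∑ j, aeval ddt (A i j) (w j)
  map_add' v w := by
    ext1 i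
    simp [Finset.sum_add_distrib]
  map_smul' r w := by
    ext1 i
    simp [Finset.smul_sum]

/-- The behavior with kernel representation `A (d/dt) w = 0`. -/
noncomputable def kerBehavior {g q : ℕ} (A : Matrix (Fin g) (Fin q) ℝ[X]) :
    Submodule ℝ (Traj q) :=
  LinearMap.ker (diffOp A)

/-- Controllers are the sets of signals that have a kernel representation
(with any finite number of rows). -/
def IsBehavior {q : ℕ} (B : Submodule ℝ (Traj q)) : Prop :=
  ∃ (k : ℕ) (A : Matrix (Fin k) (Fin q) ℝ[X]), B = kerBehavior A

/-- The rank of a polynomial matrix, over the field of rational functions. -/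
noncomputable def polyRank {m n : Type} [Fintype n] (A : Matrix m n ℝ[X]) : ℕ :=
  (A.map (algebraMap ℝ[X] (RatFunc ℝ))).rank

section Plant

variable {g nw nc : ℕ} (R : Matrix (Fin g) (Fin nw) ℝ[X]) (M : Matrix (Fin g) (Fin nc) ℝ[X])

/-- The full plant behavior: all `(w, c)` with `R (d/dt) w + M (d/dt) c = 0`. -/
noncomputable def fullPlant : Submodule ℝ (Traj nw × Traj nc) where
  carrier := {p | diffOp R p.1 + diffOp M p.2 = 0}
  add_mem' {p q} hp hq := by
    simp only [Set.mem_ofPred_eq, Prod.fst_add, Prod.snd_add, map_add] at *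
    rw [add_add_add_comm, hp, hq, add_zero]
  zero_mem' := by simp
  smul_mem' r p hp := by
    simp only [Set.mem_ofPred_eq, Prod.smul_fst, Prod.smul_snd, map_smul] at *
    rw [← smul_add, hp, smul_zero]

/-- The controlled behavior: all `w` such that `(w, c)` lies in the full plant behavior
for some `c` allowed by the controller `C`. -/
noncomputable def controlledBehavior (C : Submodule ℝ (Traj nc)) : Submodule ℝ (Traj nw) where
  carrier := {w | ∃ c : Traj nc, (w, c) ∈ fullPlant R M ∧ c ∈ C}
  add_mem' := by
    rintro w w' ⟨c, h, hc⟩ ⟨c', h', hc'⟩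
    exact ⟨c + c', by simpa only [Prod.mk_add_mk] using add_mem h h', add_mem hc hc'⟩
  zero_mem' := ⟨0, zero_mem (fullPlant R M), zero_mem C⟩
  smul_mem' := by
    rintro r w ⟨c, h, hc⟩
    exact ⟨r • c, by simpa only [Prod.smul_mk] using Submodule.smul_mem _ r h,
      Submodule.smul_mem _ r hc⟩

/-- The control manifest behavior of the plant: all `c` such that `(w, c)` lies in the full
plant behavior for some `w`. -/
noncomputable def controlManifest : Submodule ℝ (Traj nc) where
  carrier := {c | ∃ w : Traj nw, (w, c) ∈ fullPlant R M}
  add_mem' := by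
    rintro c c' ⟨w, h⟩ ⟨w', h'⟩
    exact ⟨w + w', by simpa only [Prod.mk_add_mk] using add_mem h h'⟩
  zero_mem' := ⟨0, zero_mem (fullPlant R M)⟩
  smul_mem' := by
    rintro r c ⟨w, h⟩
    exact ⟨r • w, by simpa only [Prod.smul_mk] using Submodule.smul_mem _ r h⟩

/-- The canonical controller for the specification `S`: all `c` such that `(w, c)` lies in the
full plant behavior for some `w` in `S`. -/
noncomputable def canonicalController (S : Submodule ℝ (Traj nw)) : Submodule ℝ (Traj nc) where
  carrier := {c | ∃ w : Traj nw, (w, c) ∈ fullPlant R M ∧ w ∈ S}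
  add_mem' := by
    rintro c c' ⟨w, h, hw⟩ ⟨w', h', hw'⟩
    exact ⟨w + w', by simpa only [Prod.mk_add_mk] using add_mem h h', add_mem hw hw'⟩
  zero_mem' := ⟨0, zero_mem (fullPlant R M), zero_mem S⟩
  smul_mem' := by
    rintro r c ⟨w, h, hw⟩
    exact ⟨r • w, by simpa only [Prod.smul_mk] using Submodule.smul_mem _ r h,
      Submodule.smul_mem _ r hw⟩

/-- `C` implements `S`: the controlled behavior equals `S`. -/
def Implements (C : Submodule ℝ (Traj nc)) (S : Submodule ℝ (Traj nw)) : Prop :=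
  controlledBehavior R M C = S

/-- `S` is implementable: some controller implements it. -/
def IsImplementable (S : Submodule ℝ (Traj nw)) : Prop :=
  ∃ C : Submodule ℝ (Traj nc), IsBehavior C ∧ Implements R M C S

/-- `C` is a regular controller: it is the kernel of `A (d/dt)` for a polynomial matrix `A` of
full row rank such that `rank [R M; 0 A] = rank [R M] + rank A`. -/
def IsRegularController (C : Submodule ℝ (Traj nc)) : Prop :=
  ∃ (k : ℕ) (A : Matrix (Fin k) (Fin nc) ℝ[X]),
    C = kerBehavior A ∧ polyRank A = k ∧
      polyRank (Matrix.fromBlocks R M 0 A) = polyRank (Matrix.fromCols R M) + polyRank A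

/-- `S` is regularly implementable: some regular controller implements it. -/
def IsRegularlyImplementable (S : Submodule ℝ (Traj nw)) : Prop :=
  ∃ C : Submodule ℝ (Traj nc), IsRegularController R M C ∧ Implements R M C S

/-- The class of regular controllers that are equivalent to the canonical controller. -/
def canonicalRegularClass (S : Submodule ℝ (Traj nw)) : Set (Submodule ℝ (Traj nc)) :=
  {C | IsRegularController R M C ∧
    C ⊓ controlManifest R M = canonicalController R M S ⊓ controlManifest R M}

end Plant

end Behavioral

namespace Behavioral

/-! Smooth functions form a divisible module over the principal ideal domain `ℝ[X]`, hence an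
injective one (`smoothFun_baer`). Injectivity is used twice. It makes an inhomogeneous system
solvable exactly when the syzygies of its rows annihilate the right-hand side, so latent variables
can be eliminated and `C ⊔ C_can` is again cut out by differential equations. It also shows that a
row vanishing on a kernel lies, over the rational functions, in the span of the defining rows; so
enlarging a behavior shrinks its row span. Regularity says that the row spans of plant and
controller are disjoint, hence passes to larger behaviors (`IsRegularController.of_le`).

The rest is lattice theory. If `C` implements `S`, then `C ⊓ P_c ≤ C_can ≤ P_c`, and the modular law
gives `(C ⊔ C_can) ⊓ P_c = C_can`. Conversely, a controller acts on the plant only through its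
intersection with `P_c`, and `C_can` implements every implementable `S`. -/

/-! ### Surjectivity of scalar differential operators -/

/-- The complex vector space of infinitely differentiable functions from `ℝ` to `ℂ`. -/
def smoothComplexFun : Submodule ℂ (ℝ → ℂ) where
  carrier := {f | ContDiff ℝ ∞ f}
  add_mem' {f g} hf hg := by
    rw [Set.mem_ofPred_eq] at *
    exact ContDiff.add hf hg
  zero_mem' := by
    rw [Set.mem_ofPred_eq]
    exact contDiff_const
  smul_mem' r f hf := by
    rw [Set.mem_ofPred_eq] at *
    exact ContDiff.const_smul r hf

theorem mem_smoothComplexFun {f : ℝ → ℂ} : f ∈ smoothComplexFun ↔ ContDiff ℝ ∞ f := by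
  rw [← SetLike.mem_coe, smoothComplexFun, Submodule.coe_set_mk, AddSubmonoid.coe_set_mk]
  exact Iff.rfl

theorem smoothComplexFun_differentiable (f : smoothComplexFun) :
    Differentiable ℝ (f : ℝ → ℂ) :=
  (mem_smoothComplexFun.1 f.2).differentiable (by simp)

/-- The operator `d/dt` on infinitely differentiable complex functions. -/
noncomputable def ddtComplex : smoothComplexFun →ₗ[ℂ] smoothComplexFun where
  toFun f := ⟨deriv (f : ℝ → ℂ),
    mem_smoothComplexFun.2 (contDiff_infty_iff_deriv.1 (mem_smoothComplexFun.1 f.2)).2⟩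
  map_add' f g := by
    ext t
    exact deriv_add (smoothComplexFun_differentiable f t) (smoothComplexFun_differentiable g t)
  map_smul' r f := by
    ext t
    exact deriv_const_smul r (smoothComplexFun_differentiable f t)

/-- Variation of constants: `exp (a t) * ∫ exp (-a s) f s` over `0..t` solves `y' - a y = f`. -/
theorem ddtComplex_sub_const_surjective (a : ℂ) :
    Function.Surjective (aeval ddtComplex (X - C a)) := by
  intro f
  have hf : ContDiff ℝ ∞ (f : ℝ → ℂ) := mem_smoothComplexFun.1 f.2
  have hexp : ∀ b : ℂ, ContDiff ℝ ∞ fun t : ℝ => Complex.exp (b * t) := fun b =>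
    Complex.contDiff_exp.comp (contDiff_const.mul Complex.ofRealCLM.contDiff)
  have hint : ContDiff ℝ ∞ fun t : ℝ => Complex.exp (-a * t) * (f : ℝ → ℂ) t :=
    (hexp (-a)).mul hf
  have hprim : ∀ t : ℝ, HasDerivAt
      (fun t : ℝ => ∫ s in (0 : ℝ)..t, Complex.exp (-a * s) * (f : ℝ → ℂ) s)
      (Complex.exp (-a * t) * (f : ℝ → ℂ) t) t := fun t =>
    intervalIntegral.integral_hasDerivAt_right (hint.continuous.intervalIntegrable _ _)
      hint.continuous.stronglyMeasurable.stronglyMeasurableAtFilter hint.continuous.continuousAt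
  have hG : ContDiff ℝ ∞
      fun t : ℝ => ∫ s in (0 : ℝ)..t, Complex.exp (-a * s) * (f : ℝ → ℂ) s := by
    refine contDiff_infty_iff_deriv.2 ⟨fun t => (hprim t).differentiableAt, ?_⟩
    rwa [funext fun t => (hprim t).deriv]
  have hderiv : ∀ t : ℝ, HasDerivAt (fun t : ℝ => Complex.exp (a * t))
      (a * Complex.exp (a * t)) t := by
    intro t
    have h := (((hasDerivAt_id t).ofReal_comp).const_mul a).cexp
    simpa [mul_comm] using h
  refine ⟨⟨_, mem_smoothComplexFun.2 ((hexp a).mul hG)⟩, ?_⟩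
  ext t
  simp only [map_sub, aeval_X, aeval_C, LinearMap.sub_apply, Module.algebraMap_end_apply]
  refine (congrArg (· - a * (_ * _)) ((hderiv t).mul (hprim t)).deriv).trans ?_
  have h1 : Complex.exp (a * t) * Complex.exp (-a * t) = 1 := by
    rw [← Complex.exp_add]; simp
  linear_combination (f : ℝ → ℂ) t * h1

theorem aeval_ddtComplex_surjective {p : ℂ[X]} (hp : p ≠ 0) :
    Function.Surjective (aeval ddtComplex p) := by
  rw [(IsAlgClosed.splits p).eq_prod_roots, map_mul, aeval_C]
  refine Function.Surjective.comp (g := algebraMap ℂ (Module.End ℂ smoothComplexFun) _)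
    (fun f => ⟨p.leadingCoeff⁻¹ • f, ?_⟩) ?_
  · rw [Module.algebraMap_end_apply, smul_inv_smul₀ (leadingCoeff_ne_zero.2 hp)]
  · induction p.roots using Multiset.induction with
    | empty => exact fun f => ⟨f, by simp⟩
    | cons a s ih =>
      rw [Multiset.map_cons, Multiset.prod_cons, map_mul]
      exact (ddtComplex_sub_const_surjective a).comp ih

/-- The real part of a complex smooth function. -/
noncomputable def smoothRe : smoothComplexFun →ₗ[ℝ] smoothFun where
  toFun f := ⟨fun t => ((f : ℝ → ℂ) t).re,
    mem_smoothFun.2 (Complex.reCLM.contDiff.comp (mem_smoothComplexFun.1 f.2))⟩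
  map_add' f g := rfl
  map_smul' r f := by
    ext t
    exact Complex.smul_re r _

theorem smoothRe_ddtComplex (f : smoothComplexFun) :
    smoothRe (ddtComplex f) = ddt (smoothRe f) := by
  ext t
  exact ((Complex.reCLM.hasFDerivAt.comp_hasDerivAt t
    (smoothComplexFun_differentiable f t).hasDerivAt).deriv).symm

theorem smoothRe_aeval (p : ℝ[X]) (f : smoothComplexFun) :
    smoothRe (aeval ddtComplex (p.map Complex.ofRealHom) f) = aeval ddt p (smoothRe f) := by
  induction p using Polynomial.induction_on' generalizing f with
  | add p q hp hq => simp only [Polynomial.map_add, map_add, LinearMap.add_apply, hp, hq]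
  | monomial n a =>
    have hpow : smoothRe ((ddtComplex ^ n) f) = (ddt ^ n) (smoothRe f) := by
      induction n generalizing f with
      | zero => rfl
      | succ n ih => rw [pow_succ, pow_succ, Module.End.mul_apply, Module.End.mul_apply, ih,
          smoothRe_ddtComplex]
    rw [map_monomial, aeval_monomial, aeval_monomial, Module.End.mul_apply,
      Module.End.mul_apply, Module.algebraMap_end_apply, Module.algebraMap_end_apply, ← hpow]
    ext t
    exact Complex.re_ofReal_mul a _

/-- Operators with real coefficients commute with the real part, so the real part of a complex
solution is a solution. -/
theorem aeval_ddt_surjective {p : ℝ[X]} (hp : p ≠ 0) : Function.Surjective (aeval ddt p) := by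
  intro f
  obtain ⟨y, hy⟩ := aeval_ddtComplex_surjective
    ((Polynomial.map_ne_zero_iff Complex.ofRealHom.injective).2 hp)
    ⟨fun t => ((f : ℝ → ℝ) t : ℂ), Complex.ofRealCLM.contDiff.comp (mem_smoothFun.1 f.2)⟩
  refine ⟨smoothRe y, ?_⟩
  rw [← smoothRe_aeval, hy]
  rfl

/-! ### Injectivity of the signal module -/

noncomputable instance : Module ℝ[X] smoothFun :=
  Module.compHom smoothFun (aeval ddt : ℝ[X] →ₐ[ℝ] Module.End ℝ smoothFun).toRingHom

/-- A map on the ideal `(p)` is determined by the image of `p`; dividing that image by `p` gives the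
value of an extension at `1`. -/
theorem _root_.Module.Baer.of_surjective_smul {D A : Type*} [CommRing D] [IsDomain D]
    [IsPrincipalIdealRing D] [AddCommGroup A] [Module D A]
    (h : ∀ p : D, p ≠ 0 → Function.Surjective fun f : A => p • f) : Module.Baer D A := by
  intro I g
  obtain ⟨p, rfl⟩ := (IsPrincipalIdealRing.principal I).principal
  by_cases hp : p = 0
  · subst hp
    refine ⟨0, fun x hx => ?_⟩
    have : (⟨x, hx⟩ : Submodule.span D {(0 : D)}) = 0 := by
      ext
      simpa using hx
    rw [this, map_zero, LinearMap.zero_apply]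
  · obtain ⟨y, hy⟩ := h p hp (g ⟨p, Submodule.mem_span_singleton_self p⟩)
    refine ⟨LinearMap.toSpanSingleton D A y, fun x hx => ?_⟩
    obtain ⟨r, rfl⟩ := Submodule.mem_span_singleton.1 hx
    rw [LinearMap.toSpanSingleton_apply, smul_assoc]
    refine (congrArg (r • ·) hy).trans ?_
    rw [← map_smul]
    rfl

theorem smoothFun_baer : Module.Baer ℝ[X] smoothFun :=
  .of_surjective_smul fun _ hp => aeval_ddt_surjective hp

/-- Solvability of inhomogeneous linear systems over an injective module. -/
theorem _root_.Module.Baer.exists_solution_iff {D A : Type*} [CommRing D] [AddCommGroup A]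
    [Module D A] (h : Module.Baer D A) {m n : Type*} [Fintype m] [Fintype n]
    [DecidableEq n] (L : Matrix m n D) (b : m → A) :
    (∃ x : n → A, ∀ i, Fintype.linearCombination D x (L i) = b i) ↔
      ∀ v : m → D, Matrix.vecMul v L = 0 → Fintype.linearCombination D b v = 0 := by
  constructor
  · rintro ⟨x, hx⟩ v hv
    have : Fintype.linearCombination D b v =
        Fintype.linearCombination D x (Matrix.vecMul v L) := by
      simp only [Fintype.linearCombination_apply, ← hx, Matrix.vecMul, dotProduct, Finset.sum_smul,
        Finset.smul_sum, smul_smul]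
      exact Finset.sum_comm
    rw [this, hv, map_zero]
  · intro hb
    classical
    have hle : LinearMap.ker L.vecMulLinear ≤
        LinearMap.ker (Fintype.linearCombination D b) := fun v hv => hb v hv
    -- By compatibility `vL ↦ b · v` is well defined on the row module of `L`; extend it to all of
    -- `n → D` and read off `x` on the standard basis.
    obtain ⟨y, hy⟩ := h.extension_property
      ((LinearMap.ker L.vecMulLinear).liftQ L.vecMulLinear le_rfl)
      (LinearMap.ker_eq_bot.1 (Submodule.ker_liftQ_eq_bot' _ _ rfl))
      ((LinearMap.ker L.vecMulLinear).liftQ _ hle)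
    refine ⟨fun j => y (Pi.single j 1), fun i => ?_⟩
    have h1 := LinearMap.congr_fun hy (Submodule.Quotient.mk (Pi.single i 1))
    simp only [LinearMap.comp_apply, Submodule.liftQ_apply, Matrix.vecMulLinear_apply,
      Matrix.single_one_vecMul, Fintype.linearCombination_apply_single, one_smul] at h1
    rw [← h1, Fintype.linearCombination_apply]
    conv_rhs => rw [show L.row i = L i from rfl, pi_eq_sum_univ' (L i), map_sum]
    exact Finset.sum_congr rfl fun j _ => by
      rw [← map_smul]

/-! ### Kernels and the rows that vanish on them -/

theorem mem_kerBehavior {k q : ℕ} {A : Matrix (Fin k) (Fin q) ℝ[X]} {w : Traj q} :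
    w ∈ kerBehavior A ↔ ∀ i, Fintype.linearCombination ℝ[X] w (A i) = 0 :=
  LinearMap.mem_ker.trans funext_iff

/-- The differential operators, as rows of polynomials, that vanish on `B`. -/
noncomputable def annihilator {q : ℕ} (B : Submodule ℝ (Traj q)) :
    Submodule ℝ[X] (Fin q → ℝ[X]) :=
  ⨅ w : B, LinearMap.ker (Fintype.linearCombination ℝ[X] (w : Traj q))

theorem mem_annihilator {q : ℕ} {B : Submodule ℝ (Traj q)} {v : Fin q → ℝ[X]} :
    v ∈ annihilator B ↔ ∀ w ∈ B, Fintype.linearCombination ℝ[X] w v = 0 := by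
  simp [annihilator]

/-- A set of signals cut out by differential equations is the kernel of a differential operator
with linearly independent rows. -/
theorem exists_eq_kerBehavior_linearIndependent {q : ℕ} {B : Submodule ℝ (Traj q)}
    {N : Set (Fin q → ℝ[X])}
    (hB : ∀ w, w ∈ B ↔ ∀ v ∈ N, Fintype.linearCombination ℝ[X] w v = 0) :
    ∃ (k : ℕ) (A : Matrix (Fin k) (Fin q) ℝ[X]), B = kerBehavior A ∧ LinearIndependent ℝ[X] A := by
  -- Over a principal ideal domain the annihilator is free; a basis of it supplies the rows.
  obtain ⟨k, ⟨b⟩⟩ := (annihilator B).nonempty_basis_of_pid (Pi.basisFun ℝ[X] (Fin q))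
  have hli : LinearIndependent ℝ[X] fun i => (b i : Fin q → ℝ[X]) :=
    b.linearIndependent.map' (annihilator B).subtype (Submodule.ker_subtype _)
  refine ⟨k, Matrix.of fun i => (b i : Fin q → ℝ[X]), ?_, hli⟩
  ext w
  rw [mem_kerBehavior]
  refine ⟨fun hw i => mem_annihilator.1 (b i).2 w hw, fun hw => (hB w).2 fun v hv => ?_⟩
  have hv' : v ∈ annihilator B := mem_annihilator.2 fun w hw => (hB w).1 hw v hv
  have h0 : Fintype.linearCombination ℝ[X] w ∘ₗ (annihilator B).subtype = 0 := b.ext hw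
  exact LinearMap.congr_fun h0 ⟨v, hv'⟩

/-- A row vanishing on the kernel of `A (d/dt)` has a nonzero multiple in the row module of `A`. -/
theorem exists_smul_mem_span_of_kerBehavior {k q : ℕ} {A : Matrix (Fin k) (Fin q) ℝ[X]}
    {a : Fin q → ℝ[X]}
    (ha : ∀ w ∈ kerBehavior A, Fintype.linearCombination ℝ[X] w a = 0) :
    ∃ p : ℝ[X], p ≠ 0 ∧ p • a ∈ Submodule.span ℝ[X] (Set.range A) := by
  by_contra! hcon
  set P := Submodule.span ℝ[X] (Set.range A)
  have hinj : Function.Injective (LinearMap.toSpanSingleton ℝ[X] _ (P.mkQ a)) := by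
    rw [← LinearMap.ker_eq_bot, LinearMap.ker_eq_bot']
    intro p hp
    by_contra hp0
    refine hcon p hp0 ?_
    rwa [LinearMap.toSpanSingleton_apply, ← map_smul, Submodule.mkQ_apply,
      Submodule.Quotient.mk_eq_zero] at hp
  -- If no nonzero multiple of `a` lies in `P`, its class generates a free module. Sending that
  -- class to the constant function `1` and extending yields a signal killed by `A` but not by `a`.
  obtain ⟨y, hy⟩ := smoothFun_baer.extension_property _ hinj
    (LinearMap.toSpanSingleton ℝ[X] smoothFun ⟨fun _ => 1, mem_smoothFun.2 contDiff_const⟩)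
  have hw : ∀ v, Fintype.linearCombination ℝ[X]
      (fun j => y (P.mkQ (Pi.single j 1))) v = y (P.mkQ v) := by
    intro v
    rw [Fintype.linearCombination_apply]
    conv_rhs => rw [pi_eq_sum_univ' v, map_sum, map_sum]
    exact Finset.sum_congr rfl fun j _ => by
      rw [← map_smul, ← map_smul]
  have h0 := ha (fun j => y (P.mkQ (Pi.single j 1))) <| mem_kerBehavior.2 fun i => by
    rw [hw, Submodule.mkQ_apply,
      (Submodule.Quotient.mk_eq_zero P).2 (Submodule.subset_span ⟨i, rfl⟩), map_zero]
  have h1 := LinearMap.congr_fun hy 1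
  rw [LinearMap.comp_apply, LinearMap.toSpanSingleton_apply, LinearMap.toSpanSingleton_apply,
    one_smul, one_smul, ← hw, h0] at h1
  exact zero_ne_one (congrFun (congrArg Subtype.val h1) 0)

/-! ### Ranks, row spans and regularity -/

/-- The span of the rows of a polynomial matrix over the field of rational functions. -/
noncomputable def rowSpan {m n : Type} (A : Matrix m n ℝ[X]) :
    Submodule (RatFunc ℝ) (n → RatFunc ℝ) :=
  Submodule.span (RatFunc ℝ) (Set.range (A.map (algebraMap ℝ[X] (RatFunc ℝ))).row)

theorem polyRank_eq_finrank_rowSpan {m n : Type} [Finite m] [Fintype n] (A : Matrix m n ℝ[X]) :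
    polyRank A = Module.finrank (RatFunc ℝ) (rowSpan A) :=
  Matrix.rank_eq_finrank_span_row _

theorem polyRank_of_linearIndependent {m n : Type} [Fintype m] [Fintype n] {A : Matrix m n ℝ[X]}
    (hA : LinearIndependent ℝ[X] A) : polyRank A = Fintype.card m := by
  refine LinearIndependent.rank_matrix (R := RatFunc ℝ) ?_
  refine (LinearIndependent.iff_fractionRing ℝ[X] (RatFunc ℝ)).1
    (hA.map' ((Algebra.linearMap ℝ[X] (RatFunc ℝ)).compLeft n) ?_)
  rw [LinearMap.ker_eq_bot]
  exact (IsFractionRing.injective ℝ[X] (RatFunc ℝ)).comp_left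

theorem rowSpan_fromRows {m₁ m₂ n : Type} (P : Matrix m₁ n ℝ[X]) (Q : Matrix m₂ n ℝ[X]) :
    rowSpan (Matrix.fromRows P Q) = rowSpan P ⊔ rowSpan Q := by
  rw [rowSpan, rowSpan, rowSpan, ← Submodule.span_union, ← Set.Sum.elim_range]
  refine congrArg (fun v => Submodule.span _ (Set.range v)) ?_
  ext i j
  cases i <;> rfl

/-- Extension of vectors by zero on the left. -/
noncomputable def zeroSum (l n : Type) : (n → RatFunc ℝ) →ₗ[RatFunc ℝ] (l ⊕ n → RatFunc ℝ) :=
  LinearMap.pi (Sum.elim (fun _ => 0) LinearMap.proj)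

theorem zeroSum_injective (l n : Type) : Function.Injective (zeroSum l n) := fun _ _ h =>
  funext fun j => congrFun h (Sum.inr j)

theorem rowSpan_fromCols_zero {l m n : Type} (A : Matrix m n ℝ[X]) :
    rowSpan (Matrix.fromCols (0 : Matrix m l ℝ[X]) A) = (rowSpan A).map (zeroSum l n) := by
  rw [rowSpan, rowSpan, Submodule.map_span, ← Set.range_comp]
  refine congrArg (fun v => Submodule.span _ (Set.range v)) ?_
  ext i j
  cases j
  · exact map_zero (algebraMap ℝ[X] (RatFunc ℝ))
  · rfl

theorem map_mem_rowSpan {m n : Type} {A : Matrix m n ℝ[X]} {p : ℝ[X]} (hp : p ≠ 0) {a : n → ℝ[X]}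
    (ha : p • a ∈ Submodule.span ℝ[X] (Set.range A)) :
    (fun j => algebraMap ℝ[X] (RatFunc ℝ) (a j)) ∈ rowSpan A := by
  have hle : Submodule.span ℝ[X] (Set.range A) ≤
      ((rowSpan A).restrictScalars ℝ[X]).comap
        ((Algebra.linearMap ℝ[X] (RatFunc ℝ)).compLeft n) := by
    rw [Submodule.span_le]
    rintro _ ⟨i, rfl⟩
    exact Submodule.subset_span ⟨i, rfl⟩
  have h := hle ha
  have hp' : algebraMap ℝ[X] (RatFunc ℝ) p ≠ 0 :=
    (map_ne_zero_iff _ (IsFractionRing.injective ℝ[X] (RatFunc ℝ))).2 hp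
  refine ((rowSpan A).smul_mem_iff hp').1 ?_
  convert! (Submodule.mem_comap.1 h) using 1
  ext j
  exact (map_mul _ _ _).symm

/-- The rank condition in the definition of regular controllers says that the rows of the plant
and those of the controller span independent subspaces. -/
theorem polyRank_fromBlocks_eq_add_iff {m k l n : Type} [Finite m] [Finite k]
    [Fintype l] [Fintype n] (R : Matrix m l ℝ[X]) (M : Matrix m n ℝ[X]) (A : Matrix k n ℝ[X]) :
    polyRank (Matrix.fromBlocks R M 0 A) = polyRank (Matrix.fromCols R M) + polyRank A ↔
      Disjoint (rowSpan (Matrix.fromCols R M)) ((rowSpan A).map (zeroSum l n)) := by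
  have h := Submodule.finrank_sup_add_finrank_inf_eq (rowSpan (Matrix.fromCols R M))
    ((rowSpan A).map (zeroSum l n))
  rw [← (Submodule.equivMapOfInjective _ (zeroSum_injective l n) (rowSpan A)).finrank_eq] at h
  rw [← Matrix.fromRows_fromCols_eq_fromBlocks, polyRank_eq_finrank_rowSpan,
    polyRank_eq_finrank_rowSpan, polyRank_eq_finrank_rowSpan, rowSpan_fromRows,
    rowSpan_fromCols_zero, disjoint_iff, ← Submodule.finrank_eq_zero (R := RatFunc ℝ)]
  omega

/-- A set of signals that contains a regular controller and is cut out by differential equations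
is a regular controller. -/
theorem IsRegularController.of_le {g nw nc : ℕ} {R : Matrix (Fin g) (Fin nw) ℝ[X]}
    {M : Matrix (Fin g) (Fin nc) ℝ[X]} {C B : Submodule ℝ (Traj nc)}
    (hC : IsRegularController R M C) (hCB : C ≤ B) {N : Set (Fin nc → ℝ[X])}
    (hB : ∀ w, w ∈ B ↔ ∀ v ∈ N, Fintype.linearCombination ℝ[X] w v = 0) :
    IsRegularController R M B := by
  obtain ⟨k, A, rfl, -, hA⟩ := hC
  obtain ⟨k', A', rfl, hA'⟩ := exists_eq_kerBehavior_linearIndependent hB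
  refine ⟨k', A', rfl, by rw [polyRank_of_linearIndependent hA', Fintype.card_fin], ?_⟩
  rw [polyRank_fromBlocks_eq_add_iff] at hA ⊢
  -- It suffices that the row span of `A'` lies in that of `A`.
  refine hA.mono_right (Submodule.map_mono ?_)
  rw [rowSpan, Submodule.span_le]
  rintro _ ⟨i, rfl⟩
  obtain ⟨p, hp, hpA⟩ := exists_smul_mem_span_of_kerBehavior (A := A) (a := A' i)
    fun w hw => mem_kerBehavior.1 (hCB hw) i
  exact map_mem_rowSpan hp hpA

/-! ### Elimination of latent variables -/

theorem linearCombination_sumElim {D A m n : Type*} [CommRing D] [AddCommGroup A] [Module D A]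
    [Fintype m] [Fintype n] (x : m → A) (y : n → A) (v : m ⊕ n → D) :
    Fintype.linearCombination D (Sum.elim x y) v =
      Fintype.linearCombination D x (v ∘ Sum.inl) +
        Fintype.linearCombination D y (v ∘ Sum.inr) := by
  simp [Fintype.linearCombination_apply]

theorem linearCombination_diffOp {k q : ℕ} (A : Matrix (Fin k) (Fin q) ℝ[X]) (c : Traj q)
    (v : Fin k → ℝ[X]) :
    Fintype.linearCombination ℝ[X] (diffOp A c) v =
      Fintype.linearCombination ℝ[X] c (Matrix.vecMul v A) := by
  have h : ∀ i, diffOp A c i = ∑ j, A i j • c j := fun i => rfl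
  simp only [Fintype.linearCombination_apply, h, Matrix.vecMul, dotProduct, Finset.sum_smul,
    Finset.smul_sum, smul_smul]
  exact Finset.sum_comm

theorem mem_kerBehavior_sup_canonicalController_iff {g nw nc s k : ℕ}
    (R : Matrix (Fin g) (Fin nw) ℝ[X]) (M : Matrix (Fin g) (Fin nc) ℝ[X])
    (S : Matrix (Fin s) (Fin nw) ℝ[X]) (A : Matrix (Fin k) (Fin nc) ℝ[X]) (c : Traj nc) :
    c ∈ kerBehavior A ⊔ canonicalController R M (kerBehavior S) ↔
      ∃ (w : Traj nw) (c' : Traj nc),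
        diffOp R w + diffOp M c' = 0 ∧ diffOp S w = 0 ∧ diffOp A c' = diffOp A c := by
  rw [Submodule.mem_sup]
  constructor
  · rintro ⟨c₁, h₁, c₂, ⟨w, hw, hS⟩, rfl⟩
    refine ⟨w, c₂, hw, hS, ?_⟩
    rw [map_add, LinearMap.mem_ker.1 h₁, zero_add]
  · rintro ⟨w, c', hw, hS, hA⟩
    refine ⟨c - c', ?_, c', ⟨w, hw, hS⟩, sub_add_cancel c c'⟩
    exact LinearMap.mem_ker.2 (by rw [map_sub, hA, sub_self])

/-- Elimination of the latent variables from the sum of a controller and the canonical one. -/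
theorem exists_forall_mem_kerBehavior_sup_canonicalController_iff {g nw nc s k : ℕ}
    (R : Matrix (Fin g) (Fin nw) ℝ[X]) (M : Matrix (Fin g) (Fin nc) ℝ[X])
    (S : Matrix (Fin s) (Fin nw) ℝ[X]) (A : Matrix (Fin k) (Fin nc) ℝ[X]) :
    ∃ N : Set (Fin nc → ℝ[X]), ∀ c,
      c ∈ kerBehavior A ⊔ canonicalController R M (kerBehavior S) ↔
        ∀ v ∈ N, Fintype.linearCombination ℝ[X] c v = 0 := by
  let L : Matrix ((Fin g ⊕ Fin s) ⊕ Fin k) (Fin nw ⊕ Fin nc) ℝ[X] :=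
    Matrix.fromRows (Matrix.fromBlocks R M S 0) (Matrix.fromCols 0 A)
  -- The right-hand side is `(0, 0, A c)`, so only the last block of a syzygy `v` of `L` contributes
  -- a condition on `c`.
  refine ⟨(fun v => Matrix.vecMul (v ∘ Sum.inr) A) '' {v | Matrix.vecMul v L = 0}, fun c => ?_⟩
  have h := smoothFun_baer.exists_solution_iff L (Sum.elim 0 (diffOp A c))
  rw [Set.forall_mem_image, mem_kerBehavior_sup_canonicalController_iff]
  simp only [linearCombination_sumElim, linearCombination_diffOp] at h
  refine Iff.trans ?_ (h.trans ?_)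
  · have hL : ∀ (w : Traj nw) (c' : Traj nc),
        (∀ i, Fintype.linearCombination ℝ[X] (Sum.elim w c') (L i) =
          (Sum.elim 0 (diffOp A c) : (Fin g ⊕ Fin s) ⊕ Fin k → smoothFun) i) ↔
        diffOp R w + diffOp M c' = 0 ∧ diffOp S w = 0 ∧ diffOp A c' = diffOp A c := by
      intro w c'
      simp only [linearCombination_sumElim, Sum.forall, funext_iff, and_assoc]
      refine and_congr Iff.rfl (and_congr (forall_congr' fun i => ?_) (forall_congr' fun i => ?_))
      · refine Eq.congr (Eq.trans (congrArg _ (map_zero _)) (add_zero _)) rfl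
      · refine Eq.congr (Eq.trans (congrArg (· + _) (map_zero _)) (zero_add _)) rfl
    constructor
    · rintro ⟨w, c', hw⟩
      exact ⟨Sum.elim w c', (hL w c').2 hw⟩
    · rintro ⟨x, hx⟩
      refine ⟨x ∘ Sum.inl, x ∘ Sum.inr, (hL _ _).1 ?_⟩
      rwa [Sum.elim_comp_inl_inr]
  · refine forall_congr' fun v => imp_congr Iff.rfl (Eq.congr ?_ rfl)
    rw [add_eq_right]
    simp [Fintype.linearCombination_apply]

/-! ### Lattice relations between controllers -/

section Plant

variable {g nw nc : ℕ} {R : Matrix (Fin g) (Fin nw) ℝ[X]} {M : Matrix (Fin g) (Fin nc) ℝ[X]}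
  {S : Submodule ℝ (Traj nw)} {C : Submodule ℝ (Traj nc)}

theorem canonicalController_le_controlManifest :
    canonicalController R M S ≤ controlManifest R M :=
  fun _ ⟨w, h, _⟩ => ⟨w, h⟩

theorem controlledBehavior_inf_controlManifest :
    controlledBehavior R M (C ⊓ controlManifest R M) = controlledBehavior R M C := by
  ext w
  exact ⟨fun ⟨c, h, hc⟩ => ⟨c, h, hc.1⟩, fun ⟨c, h, hc⟩ => ⟨c, h, hc, w, h⟩⟩

/-- If `(w, c)`, `(w', c)` and `(w', c')` lie in the plant, so does `(w, c) - (w', c) + (w', c') =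
(w, c')`. Hence `w` is allowed by the same `c'` in `C` as `w'`. -/
theorem IsImplementable.implements_canonicalController (hS : IsImplementable R M S) :
    Implements R M (canonicalController R M S) S := by
  obtain ⟨C, -, rfl⟩ := hS
  ext w
  constructor
  · rintro ⟨c, h, w', h', c', h'', hc'⟩
    refine ⟨c', ?_, hc'⟩
    convert! add_mem (sub_mem h h') h'' using 1
    simp
  · rintro ⟨c, h, hc⟩
    exact ⟨c, h, w, h, c, h, hc⟩

theorem Implements.inf_controlManifest_le (hC : Implements R M C S) :
    C ⊓ controlManifest R M ≤ canonicalController R M S := by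
  rintro c ⟨hc, w, h⟩
  exact ⟨w, h, hC.le ⟨c, h, hc⟩⟩

end Plant

end Behavioral

theorem mainTheorem2 {g nw nc s : ℕ}
    (R : Matrix (Fin g) (Fin nw) (Polynomial ℝ)) (M : Matrix (Fin g) (Fin nc) (Polynomial ℝ))
    (S : Matrix (Fin s) (Fin nw) (Polynomial ℝ))
    (hS : Behavioral.IsImplementable R M (Behavioral.kerBehavior S)) :
    ((Behavioral.canonicalRegularClass R M (Behavioral.kerBehavior S)).Nonempty ↔
      Behavioral.IsRegularlyImplementable R M (Behavioral.kerBehavior S)) ∧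
    ∀ C : Submodule ℝ (Behavioral.Traj nc),
      Behavioral.IsRegularController R M C →
      Behavioral.Implements R M C (Behavioral.kerBehavior S) →
      C ⊔ Behavioral.canonicalController R M (Behavioral.kerBehavior S) ∈
        Behavioral.canonicalRegularClass R M (Behavioral.kerBehavior S) := by
  have key : ∀ C : Submodule ℝ (Behavioral.Traj nc),
      Behavioral.IsRegularController R M C →
      Behavioral.Implements R M C (Behavioral.kerBehavior S) →
      C ⊔ Behavioral.canonicalController R M (Behavioral.kerBehavior S) ∈
        Behavioral.canonicalRegularClass R M (Behavioral.kerBehavior S) := by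
    intro C hC hCS
    have hle := Behavioral.canonicalController_le_controlManifest (R := R) (M := M)
      (S := Behavioral.kerBehavior S)
    refine ⟨?_, ?_⟩
    · obtain ⟨k, A, rfl, -⟩ := id hC
      obtain ⟨N, hN⟩ := Behavioral.exists_forall_mem_kerBehavior_sup_canonicalController_iff R M S A
      exact hC.of_le le_sup_left hN
    -- Modular law, applicable because `C_can ≤ P_c`.
    · rw [inf_eq_left.2 hle, sup_comm, sup_inf_assoc_of_le C hle]
      exact sup_eq_left.2 hCS.inf_controlManifest_le
  refine ⟨⟨?_, fun ⟨C, hC, hCS⟩ => ⟨_, key C hC hCS⟩⟩, key⟩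
  rintro ⟨C, hC, hCS⟩
  refine ⟨C, hC, ?_⟩
  rw [Behavioral.Implements, ← Behavioral.controlledBehavior_inf_controlManifest, hCS,
    Behavioral.controlledBehavior_inf_controlManifest]
  exact hS.implements_canonicalController
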